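/- Let $\mathscr{U}$ be the set of bounded real sequences $u=(u_1,u_2,u_3,\dots)$, and for $c\in\mathbb{R}$ and $u\in\mathscr{U}$ let $(c,u)=(c,u_1,u_2,\dots)$. Write $u>v$ if $u_t\ge v_t$ for all $t\ge 1$ and $u_t>v_t$ for some $t\ge 1$, and let $\bar u=\lim_{n\to\infty}\frac1n\sum_{t=1}^n u_t$ whenever this limit exists. Let $\succsim$ be a reflexive and transitive relation on $\mathscr{U}$; write $u\succ v$ if $u\succsim v$ but not $v\succsim u$, and $u\sim v$ if $u\succsim v$ and $v\succsim u$. Suppose that A1. for all $u,v\in\mathscr{U}$, if $u>v$, then $u\succ v$; A2. for all $u,v,\alpha\in\mathscr{U}$, if $u\succsim v$, then $u+\alpha\succsim v+\alpha$; A3. for all $u\in\mathscr{U}$, if $\bar u$ is well defined, then $(\bar u,u)\sim u$. Consider Markov decision processes with a finite state set $\mathcal{S}=\{1,\dots,S\}$ and a finite action set $A$, where for each $f\colon\mathcal{S}\to A$ the matrix $\mathbf{Q}(f)$ has as its entry $(s,s')$ the probability of moving from $s$ to $s'$ when the action $f(s)$ is chosen, and $\mathbf{R}(f)$ is the vector whose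 entry $s$ is the real reward received in state $s$ under action $f(s)$. Let $\mathscr{U}_{\text{stat}}\subset\mathscr{U}$ be the set of all streams of expected rewards $u_t=[\mathbf{Q}(f)^{t-1}\mathbf{R}(f)]_s$, $t\ge 1$, generated by a stationary policy $(f,f,f,\dots)$ from an initial state $s$ in some such process (different streams may come from different processes). Then for all $u,v\in\mathscr{U}_{\text{stat}}$, $$u\succsim v\iff \liminf_{\beta\to1^-}\sum_{t=1}^\infty\beta^t(u_t-v_t)\ge 0$$ and $$u\succsim v\iff \liminf_{n\to\infty}\frac1n\sum_{T=1}^n\sum_{t=1}^T(u_t-v_t)\ge 0,$$ that is, on $\mathscr{U}_{\text{stat}}$ the relation $\succsim$ coincides with the 1-optimality relation and with Veinott's average-overtaking relation. (The lower limits are taken in $[-\infty,+\infty]$.) -/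

import Mathlib

open Filter Topology
open scoped ENNReal

noncomputable section

namespace Blackwell

/-- The set `𝒰` of bounded real sequences (that is, `ℓ^∞`). Sequences are indexed from `0`, so the
entry `u t` is the reward received at time `t + 1`, written `u_{t+1}` when time starts at `1`. -/
abbrev RewardStream : Type := lp (fun _ : ℕ => ℝ) ∞

/-- The sequence `(c, u₁, u₂, …)`. -/
def consSeq (c : ℝ) (u : ℕ → ℝ) : ℕ → ℝ
  | 0 => c
  | t + 1 => u t

theorem memℓp_consSeq (c : ℝ) (u : RewardStream) :
    Memℓp (E := fun _ : ℕ => ℝ) (consSeq c u) ∞ := by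
  refine memℓp_infty ⟨max ‖c‖ ‖u‖, ?_⟩
  rintro _ ⟨t, rfl⟩
  cases t with
  | zero => exact le_max_left _ _
  | succ t => exact (lp.norm_apply_le_norm ENNReal.top_ne_zero u t).trans (le_max_right _ _)

/-- The bounded stream `(c, u)`: the stream `u` postponed by one period, with `c` received first. -/
def RewardStream.cons (c : ℝ) (u : RewardStream) : RewardStream :=
  ⟨consSeq c u, memℓp_consSeq c u⟩

/-- `u > v`: `u_t ≥ v_t` for all `t`, and `u_t > v_t` for some `t`. -/
def Dominates (u v : RewardStream) : Prop :=
  (∀ t, v t ≤ u t) ∧ ∃ t, v t < u t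

/-- The long-run average of `u` is well defined and equal to `c`. -/
def HasLongRunAverage (u : RewardStream) (c : ℝ) : Prop :=
  Tendsto (fun n : ℕ => (1 / (n : ℝ)) * ∑ t ∈ Finset.range n, u t) atTop (𝓝 c)

/-- `u ≻ v`, the strict part of `≿`. -/
def StrictlyBetter (R : RewardStream → RewardStream → Prop) (u v : RewardStream) : Prop :=
  R u v ∧ ¬ R v u

/-- `u ∼ v`, the symmetric part of `≿`. -/
def EquallyGood (R : RewardStream → RewardStream → Prop) (u v : RewardStream) : Prop :=
  R u v ∧ R v u

/-- Strict monotonicity. -/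
def AxiomA1 (R : RewardStream → RewardStream → Prop) : Prop :=
  ∀ u v : RewardStream, Dominates u v → StrictlyBetter R u v

/-- Invariance under the addition of a common stream. -/
def AxiomA2 (R : RewardStream → RewardStream → Prop) : Prop :=
  ∀ u v α : RewardStream, R u v → R (u + α) (v + α)

/-- The compensation principle. -/
def AxiomA3 (R : RewardStream → RewardStream → Prop) : Prop :=
  ∀ (u : RewardStream) (c : ℝ), HasLongRunAverage u c → EquallyGood R (RewardStream.cons c u) u

/-- The relation `≿_B` of 1-optimality. The lower limit is taken in the extended reals, since it can
be infinite; the series converges absolutely for `|β| < 1` because the streams are bounded. -/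
def PrefB (u v : RewardStream) : Prop :=
  0 ≤ liminf (fun β : ℝ => ((∑' t : ℕ, β ^ (t + 1) * (u t - v t) : ℝ) : EReal)) (𝓝[<] (1 : ℝ))

/-- The relation `≿_V` of average overtaking; the lower limit is taken in the extended reals. The
inner sum over `Finset.range (T + 1)` is the sum of the first `T + 1` terms. -/
def PrefV (u v : RewardStream) : Prop :=
  0 ≤ liminf (fun n : ℕ => (((1 / (n : ℝ)) *
    ∑ T ∈ Finset.range n, ∑ t ∈ Finset.range (T + 1), (u t - v t) : ℝ) : EReal)) atTop

/-- A Markov decision process with finite state space `S` and action set `A`: in state `s`, action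
`a` yields the reward `reward a s` and leads to state `s'` with probability `prob a s s'`. -/
structure MDP (S A : Type) [Fintype S] where
  reward : A → S → ℝ
  prob : A → S → S → ℝ
  prob_nonneg : ∀ a s s', 0 ≤ prob a s s'
  prob_sum : ∀ a s, ∑ s', prob a s s' = 1

namespace MDP

variable {S A : Type} [Fintype S] [DecidableEq S]

/-- The transition matrix `Q(f)` of a decision rule `f : S → A`. -/
def transition (M : MDP S A) (f : S → A) : Matrix S S ℝ :=
  Matrix.of fun s s' => M.prob (f s) s s'

/-- The reward vector `R(f)` of a decision rule `f : S → A`. -/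
def rewardVec (M : MDP S A) (f : S → A) : S → ℝ :=
  fun s => M.reward (f s) s

/-- The product of the transition matrices of the first `t` decision rules, in order of time. -/
def transitionProd (M : MDP S A) (π : ℕ → S → A) : ℕ → Matrix S S ℝ
  | 0 => 1
  | t + 1 => transitionProd M π t * M.transition (π t)

/-- The sequence of expected rewards generated by the policy `π` from the initial state `s`. -/
def expectedReward (M : MDP S A) (π : ℕ → S → A) (s : S) (t : ℕ) : ℝ :=
  (M.transitionProd π t).mulVec (M.rewardVec (π t)) s

end MDP

/-- A policy (a sequence of decision rules) is stationary if all its rules agree with the first. -/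
def IsStationary {S A : Type} (π : ℕ → S → A) : Prop :=
  ∀ t, π t = π 0

/-- The set `𝒰_stat` of the streams generated by some stationary policy from some initial state in
some Markov decision process with finitely many states and finitely many actions. -/
def UStat : Set RewardStream :=
  {u | ∃ (n : ℕ) (A : Type) (_ : Finite A) (M : MDP (Fin n) A) (π : ℕ → Fin n → A) (s : Fin n),
    IsStationary π ∧ ∀ t, u t = M.expectedReward π s t}

/-- The relations `R` and `R'` coincide on the set `D`. -/
def CoincideOn (R R' : RewardStream → RewardStream → Prop) (D : Set RewardStream) : Prop :=
  ∀ u ∈ D, ∀ v ∈ D, (R u v ↔ R' u v)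

end Blackwell

end

/-! A stochastic matrix `Q` is power-bounded, so the mean ergodic decomposition, applied twice,
writes a reward vector as `g + (1 - Q)² z` with `Q g = g`. Hence a stationary stream is a constant
plus the second difference of a bounded sequence, and so is the difference `d` of two such streams,
with gain `c` and bias `b`. All three relations turn out to compare `(c, b)` with `(0, 0)`
lexicographically.

For the two criteria this follows by telescoping: the discounted sum is `c * β / (1 - β) + b +
o(1)`, the averaged partial sum `c * (n + 1) / 2 + b + o(1)`.

For the axiomatic relation, A3 and A2 make `(y₀ - y₁, y₁ - y₂, …)` as good as `(y₀, 0, 0, …)` when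
`y` has mean zero (`equallyGood_single`). If `c = 0`, this gives `d ∼ (b, 0, 0, …)`, and A1 decides
by the sign of `b`. If `c > 0`, stopping the gain after `K` periods gives a worse stream equivalent
to `(b + c * K, 0, 0, …)`, already better than `0` for large `K`. -/

namespace Blackwell

/-! ### Mean ergodic decomposition -/

section MeanErgodic

variable {V : Type*} [NormedAddCommGroup V] [NormedSpace ℝ V]

/-- A fixed vector of a power-bounded operator `T` that lies in the range of `1 - T` vanishes. -/
theorem disjoint_ker_range_one_sub (T : Module.End ℝ V)
    (hT : ∀ x, ∃ C : ℝ, ∀ t : ℕ, ‖(T ^ t) x‖ ≤ C) :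
    Disjoint (LinearMap.ker (1 - T)) (LinearMap.range (1 - T)) := by
  rw [Submodule.disjoint_def]
  rintro x hx ⟨y, rfl⟩
  set x := (1 - T) y with hxy
  have hTx : T x = x := by
    have h : x - T x = 0 := by simpa using hx
    exact (sub_eq_zero.mp h).symm
  have hTy : T y = y - x := by simp [hxy]
  -- Each application of `T` subtracts the fixed vector `x`, so a nonzero `x` would make the orbit
  -- of `y` unbounded.
  have hpow : ∀ t : ℕ, (T ^ t) y = y - (t : ℝ) • x := by
    intro t
    induction t with
    | zero => simp
    | succ t ih =>
      rw [pow_succ', Module.End.mul_apply, ih, map_sub, map_smul, hTx, hTy]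
      push_cast
      module
  obtain ⟨C, hC⟩ := hT y
  by_contra hne
  have hpos : 0 < ‖x‖ := norm_pos_iff.mpr hne
  obtain ⟨N, hN⟩ := exists_nat_gt ((C + ‖y‖) / ‖x‖)
  have h1 : ‖(N : ℝ) • x‖ ≤ C + ‖y‖ := by
    have h2 : (N : ℝ) • x = y - (T ^ N) y := by rw [hpow]; module
    rw [h2]
    linarith [norm_sub_le y ((T ^ N) y), hC N]
  rw [norm_smul, Real.norm_natCast] at h1
  rw [div_lt_iff₀ hpos] at hN
  linarith

/-- Mean ergodic decomposition for a power-bounded operator in finite dimension, applied twice. -/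
theorem exists_eq_fixed_add_second_difference [FiniteDimensional ℝ V] (T : Module.End ℝ V)
    (hT : ∀ x, ∃ C : ℝ, ∀ t : ℕ, ‖(T ^ t) x‖ ≤ C) (x : V) :
    ∃ g z : V, T g = g ∧ x = g + (z - (2 : ℝ) • T z + T (T z)) := by
  have htop : LinearMap.ker (1 - T) ⊔ LinearMap.range (1 - T) = ⊤ := by
    refine Submodule.eq_top_of_disjoint _ _ ?_ (disjoint_ker_range_one_sub T hT)
    rw [add_comm, LinearMap.finrank_range_add_finrank_ker]
  have hdecomp : ∀ x : V, ∃ g y : V, T g = g ∧ x = g + (y - T y) := by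
    intro x
    obtain ⟨g, hg, w, ⟨y, rfl⟩, h⟩ := Submodule.mem_sup.mp (htop ▸ Submodule.mem_top : x ∈ _)
    refine ⟨g, y, ?_, by simpa using h.symm⟩
    have h : g - T g = 0 := by simpa using hg
    exact (sub_eq_zero.mp h).symm
  obtain ⟨g, y, hg, rfl⟩ := hdecomp x
  -- The fixed part `k` of `y` is killed by `1 - T`, which leaves `(1 - T)² z`.
  obtain ⟨k, z, hk, rfl⟩ := hdecomp y
  refine ⟨g, z, hg, ?_⟩
  simp only [map_add, map_sub, hk]
  module

end MeanErgodic

/-- `u` equals a constant `c` plus the second difference of a bounded sequence `z` with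
`z 0 - z 1 = b`. Then `c` is the gain (the long-run average) of `u`, and `b` is its bias. -/
def HasGainBias (u : ℕ → ℝ) (c b : ℝ) : Prop :=
  ∃ (z : ℕ → ℝ) (C : ℝ), (∀ t, |z t| ≤ C) ∧ z 0 - z 1 = b ∧
    ∀ t, u t = c + (z t - 2 * z (t + 1) + z (t + 2))

theorem HasGainBias.sub {u v : ℕ → ℝ} {c b c' b' : ℝ} (hu : HasGainBias u c b)
    (hv : HasGainBias v c' b') : HasGainBias (fun t => u t - v t) (c - c') (b - b') := by
  obtain ⟨z, C, hz, hb, h⟩ := hu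
  obtain ⟨z', C', hz', hb', h'⟩ := hv
  refine ⟨fun t => z t - z' t, C + C', fun t => ?_, ?_, fun t => ?_⟩
  · exact (abs_sub _ _).trans (add_le_add (hz t) (hz' t))
  · linarith
  · simp only [h, h']
    ring

/-! ### Gain and bias of stationary streams -/

section Stochastic

variable {S A : Type} [Fintype S]

/-- Each row is a probability vector, so it averages the entries of `x`. This gives
power-boundedness. -/
theorem MDP.norm_transition_mulVec_le (M : MDP S A) (f : S → A) (x : S → ℝ) :
    ‖(M.transition f).mulVec x‖ ≤ ‖x‖ := by
  refine (pi_norm_le_iff_of_nonneg (norm_nonneg x)).mpr fun s => ?_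
  calc ‖(M.transition f).mulVec x s‖
      ≤ ∑ s', ‖M.prob (f s) s s' * x s'‖ := norm_sum_le _ _
    _ ≤ ∑ s', M.prob (f s) s s' * ‖x‖ := by
        refine Finset.sum_le_sum fun s' _ => ?_
        rw [norm_mul, Real.norm_of_nonneg (M.prob_nonneg _ _ _)]
        exact mul_le_mul_of_nonneg_left (norm_le_pi_norm x s') (M.prob_nonneg _ _ _)
    _ = ‖x‖ := by rw [← Finset.sum_mul, M.prob_sum, one_mul]

variable [DecidableEq S]

theorem MDP.expectedReward_of_isStationary (M : MDP S A) {π : ℕ → S → A} (hπ : IsStationary π)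
    (s : S) (t : ℕ) :
    M.expectedReward π s t =
      ((M.transition (π 0)).mulVecLin ^ t : Module.End ℝ (S → ℝ)) (M.rewardVec (π 0)) s := by
  have hprod : ∀ t, M.transitionProd π t = M.transition (π 0) ^ t := by
    intro t
    induction t with
    | zero => rfl
    | succ t ih => rw [MDP.transitionProd, ih, hπ t, pow_succ]
  have hpow : ∀ (t : ℕ) (x : S → ℝ), (M.transition (π 0) ^ t).mulVec x =
      ((M.transition (π 0)).mulVecLin ^ t : Module.End ℝ (S → ℝ)) x := by
    intro t
    induction t with
    | zero => simp
    | succ t ih =>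
      intro x
      rw [pow_succ, pow_succ, Module.End.mul_apply, ← ih, Matrix.mulVecLin_apply,
        Matrix.mulVec_mulVec]
  rw [MDP.expectedReward, hprod, hπ t, hpow]

theorem MDP.hasGainBias_expectedReward (M : MDP S A) {π : ℕ → S → A} (hπ : IsStationary π)
    (s : S) : ∃ c b, HasGainBias (M.expectedReward π s) c b := by
  set T : Module.End ℝ (S → ℝ) := (M.transition (π 0)).mulVecLin with hTdef
  have hnorm : ∀ (x : S → ℝ) (t : ℕ), ‖(T ^ t) x‖ ≤ ‖x‖ := by
    intro x t
    induction t with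
    | zero => simp
    | succ t ih =>
      rw [pow_succ', Module.End.mul_apply]
      exact (M.norm_transition_mulVec_le (π 0) _).trans ih
  obtain ⟨g, z, hg, hr⟩ := exists_eq_fixed_add_second_difference T (fun x => ⟨‖x‖, hnorm x⟩)
    (M.rewardVec (π 0))
  have hgpow : ∀ t : ℕ, (T ^ t) g = g := by
    intro t
    induction t with
    | zero => simp
    | succ t ih => rw [pow_succ, Module.End.mul_apply, hg, ih]
  refine ⟨g s, _, fun t => (T ^ t) z s, ‖z‖, fun t => ?_, rfl, fun t => ?_⟩
  · exact (norm_le_pi_norm ((T ^ t) z) s).trans (hnorm z t)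
  · rw [M.expectedReward_of_isStationary hπ, ← hTdef, hr]
    simp [hgpow, pow_succ]

end Stochastic

theorem hasGainBias_of_mem_UStat {u : RewardStream} (hu : u ∈ UStat) :
    ∃ c b, HasGainBias u c b := by
  obtain ⟨n, A, _, M, π, s, hπ, h⟩ := hu
  rw [show (u : ℕ → ℝ) = M.expectedReward π s from funext h]
  exact M.hasGainBias_expectedReward hπ s

/-! ### Asymptotics of the two criteria -/

/-- Telescoping discounted sums of a bounded sequence. -/
theorem hasSum_pow_mul_sub {y : ℕ → ℝ} {C : ℝ} (hy : ∀ t, |y t| ≤ C) {β : ℝ} (h0 : 0 < β)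
    (h1 : β < 1) :
    HasSum (fun t => β ^ (t + 1) * (y t - y (t + 1)))
      (y 0 - (1 - β) * ∑' t, β ^ t * y t) := by
  have hs : Summable fun t => β ^ t * y t := by
    refine Summable.of_norm_bounded
      (g := fun t => β ^ t * C) ((summable_geometric_of_lt_one h0.le h1).mul_right C) fun t => ?_
    rw [norm_mul, norm_pow, Real.norm_of_nonneg h0.le]
    exact mul_le_mul_of_nonneg_left (hy t) (pow_nonneg h0.le t)
  have ha := hs.hasSum.mul_left β
  have hb := (hasSum_nat_add_iff' 1).mpr hs.hasSum
  rw [Finset.sum_range_one, pow_zero, one_mul] at hb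
  have h2 : (fun t => β ^ (t + 1) * (y t - y (t + 1))) =
      fun t => β * (β ^ t * y t) - β ^ (t + 1) * y (t + 1) := by
    ext t
    ring
  have h3 : y 0 - (1 - β) * ∑' t, β ^ t * y t =
      β * ∑' t, β ^ t * y t - (∑' t, β ^ t * y t - y 0) := by ring
  rw [h2, h3]
  exact ha.sub hb

theorem abs_tsum_pow_mul_le {y : ℕ → ℝ} {C : ℝ} (hy : ∀ t, |y t| ≤ C) {β : ℝ} (h0 : 0 < β)
    (h1 : β < 1) : |(1 - β) * ∑' t, β ^ t * y t| ≤ C := by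
  have hle : ‖∑' t, β ^ t * y t‖ ≤ (1 - β)⁻¹ * C := by
    refine tsum_of_norm_bounded ((hasSum_geometric_of_lt_one h0.le h1).mul_right C) fun t => ?_
    rw [norm_mul, norm_pow, Real.norm_of_nonneg h0.le]
    exact mul_le_mul_of_nonneg_left (hy t) (pow_nonneg h0.le t)
  have hpos : 0 < 1 - β := by linarith
  rw [abs_mul, abs_of_pos hpos]
  calc (1 - β) * |∑' t, β ^ t * y t| ≤ (1 - β) * ((1 - β)⁻¹ * C) :=
        mul_le_mul_of_nonneg_left hle hpos.le
    _ = C := by field_simp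

/-- The first two terms of the Laurent expansion of the discounted value. -/
theorem HasGainBias.exists_discounted_eq {d : ℕ → ℝ} {c b : ℝ} (h : HasGainBias d c b) :
    ∃ (e : ℝ → ℝ), Tendsto e (𝓝[<] (1 : ℝ)) (𝓝 0) ∧ ∀ β : ℝ, 0 < β → β < 1 →
      ∑' t, β ^ (t + 1) * d t = c * (β * (1 - β)⁻¹) + (b + e β) := by
  obtain ⟨z, C, hz, hb, hd⟩ := h
  set y : ℕ → ℝ := fun t => z t - z (t + 1) with hydef
  have hy : ∀ t, |y t| ≤ C + C := fun t =>
    (abs_sub _ _).trans (add_le_add (hz t) (hz (t + 1)))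
  refine ⟨fun β => -((1 - β) * ∑' t, β ^ t * y t), ?_, ?_⟩
  · rw [← neg_zero]
    refine Tendsto.neg ?_
    have hlim : Tendsto (fun β : ℝ => (1 - β) * (β⁻¹ * (C + C))) (𝓝[<] (1 : ℝ)) (𝓝 0) := by
      have hc : ContinuousAt (fun β : ℝ => (1 - β) * (β⁻¹ * (C + C))) 1 := by
        fun_prop (disch := norm_num)
      have := hc.tendsto.mono_left (nhdsWithin_le_nhds (s := Set.Iio 1))
      simpa using this
    refine squeeze_zero_norm' ?_ hlim
    filter_upwards [Ioo_mem_nhdsLT (zero_lt_one' ℝ)] with β hβ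
    obtain ⟨h0, h1⟩ := hβ
    have hpos : 0 ≤ 1 - β := by linarith
    rw [norm_mul, Real.norm_of_nonneg hpos]
    refine mul_le_mul_of_nonneg_left ?_ hpos
    -- Since `y` is itself a difference, telescoping again bounds this sum near `β = 1`, so the
    -- factor `1 - β` sends the error to zero.
    have hs : ∑' t, β ^ t * y t = β⁻¹ * (z 0 - (1 - β) * ∑' t, β ^ t * z t) := by
      rw [← (hasSum_pow_mul_sub hz h0 h1).tsum_eq, ← tsum_mul_left]
      congr 1
      ext t
      rw [pow_succ]
      field_simp
      rfl
    rw [hs, norm_mul, norm_inv, Real.norm_of_nonneg h0.le]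
    refine mul_le_mul_of_nonneg_left ?_ (inv_nonneg.mpr h0.le)
    exact (abs_sub _ _).trans (add_le_add (hz 0) (abs_tsum_pow_mul_le hz h0 h1))
  · intro β h0 h1
    have hsum := (((hasSum_geometric_of_lt_one h0.le h1).mul_left β).mul_left c).add
      (hasSum_pow_mul_sub hy h0 h1)
    have h2 : (fun t => β ^ (t + 1) * d t) = fun t =>
        c * (β * β ^ t) + β ^ (t + 1) * (y t - y (t + 1)) := by
      ext t
      simp only [hd, hydef]
      ring
    rw [h2, hsum.tsum_eq, ← hb]
    ring

/-- Summing twice undoes the second difference: apart from the terms in `c` and `b`, only `z (n + 1)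
- z 1` survives, and dividing by `n` removes it in the limit. -/
theorem HasGainBias.exists_average_eq {d : ℕ → ℝ} {c b : ℝ} (h : HasGainBias d c b) :
    ∃ (e : ℕ → ℝ), Tendsto e atTop (𝓝 0) ∧ ∀ n : ℕ, 0 < n →
      (1 / (n : ℝ)) * ∑ T ∈ Finset.range n, ∑ t ∈ Finset.range (T + 1), d t =
        c * (((n : ℝ) + 1) / 2) + (b + e n) := by
  obtain ⟨z, C, hz, hb, hd⟩ := h
  refine ⟨fun n => (1 / (n : ℝ)) * (z (n + 1) - z 1), ?_, ?_⟩
  · refine squeeze_zero_norm (a := fun n : ℕ => (C + C) * (1 / (n : ℝ))) (fun n => ?_) ?_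
    · rw [norm_mul, mul_comm, Real.norm_of_nonneg (by positivity : (0 : ℝ) ≤ 1 / (n : ℝ))]
      refine mul_le_mul_of_nonneg_right ?_ (by positivity)
      exact (abs_sub _ _).trans (add_le_add (hz _) (hz _))
    · simpa using tendsto_one_div_atTop_nhds_zero_nat.const_mul (C + C)
  · intro n hn
    have hinner : ∀ T : ℕ, ∑ t ∈ Finset.range T, d t =
        c * T + (b - (z T - z (T + 1))) := by
      intro T
      induction T with
      | zero => simp [← hb]
      | succ T ih =>
        rw [Finset.sum_range_succ, ih, hd]
        push_cast
        ring
    have houter : ∀ n : ℕ, ∑ T ∈ Finset.range n, ∑ t ∈ Finset.range (T + 1), d t =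
        c * (n * (n + 1) / 2) + n * b + (z (n + 1) - z 1) := by
      intro n
      induction n with
      | zero => simp
      | succ n ih =>
        rw [Finset.sum_range_succ, ih, hinner]
        push_cast
        ring
    have hn' : (n : ℝ) ≠ 0 := by positivity
    rw [houter]
    field_simp
    ring

/-- The sign of the lower limit of a function with expansion `c * g + b + o(1)`, where `g → ∞`, is
determined lexicographically by `(c, b)`. -/
theorem zero_le_liminf_iff {ι : Type*} {l : Filter ι} [l.NeBot] {f g e : ι → ℝ} {c b : ℝ}
    (hg : Tendsto g l atTop) (he : Tendsto e l (𝓝 0)) (hf : ∀ᶠ i in l, f i = c * g i + (b + e i)) :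
    0 ≤ liminf (fun i => (f i : EReal)) l ↔ 0 < c ∨ c = 0 ∧ 0 ≤ b := by
  have hbe : Tendsto (fun i => b + e i) l (𝓝 b) := by simpa using he.const_add b
  rcases lt_trichotomy c 0 with hc | hc | hc
  · have hlim : Tendsto f l atBot :=
      ((hg.const_mul_atTop_of_neg hc).atBot_add hbe).congr' (hf.mono fun _ h => h.symm)
    have hE := (EReal.tendsto_coe_nhds_bot_iff.mpr hlim).liminf_eq
    rw [hE]
    simp [hc.not_gt, hc.ne]
  · subst hc
    have hlim : Tendsto f l (𝓝 b) :=
      hbe.congr' (hf.mono fun _ h => by rw [h]; ring)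
    have hE := (EReal.tendsto_coe.mpr hlim).liminf_eq
    rw [hE]
    simp
  · have hlim : Tendsto f l atTop :=
      ((hg.const_mul_atTop hc).atTop_add hbe).congr' (hf.mono fun _ h => h.symm)
    have hE := (EReal.tendsto_coe_nhds_top_iff.mpr hlim).liminf_eq
    rw [hE]
    simp [hc]

theorem prefB_iff {u v : RewardStream} {c b : ℝ} (h : HasGainBias (fun t => u t - v t) c b) :
    PrefB u v ↔ 0 < c ∨ c = 0 ∧ 0 ≤ b := by
  obtain ⟨e, he, hd⟩ := h.exists_discounted_eq
  refine zero_le_liminf_iff (g := fun β : ℝ => β * (1 - β)⁻¹) (e := e) ?_ he ?_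
  · have h1 : Tendsto (fun β : ℝ => 1 - β) (𝓝[<] (1 : ℝ)) (𝓝[>] 0) := by
      refine tendsto_nhdsWithin_iff.mpr ⟨?_, ?_⟩
      · have hc : ContinuousAt (fun β : ℝ => 1 - β) 1 := by fun_prop
        simpa using hc.tendsto.mono_left (nhdsWithin_le_nhds (s := Set.Iio 1))
      · filter_upwards [self_mem_nhdsWithin] with β hβ
        exact sub_pos.mpr (Set.mem_Iio.mp hβ)
    exact Tendsto.pos_mul_atTop one_pos (tendsto_id.mono_left nhdsWithin_le_nhds)
      (tendsto_inv_nhdsGT_zero.comp h1)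
  · filter_upwards [Ioo_mem_nhdsLT (zero_lt_one' ℝ)] with β hβ
    exact hd β hβ.1 hβ.2

theorem prefV_iff {u v : RewardStream} {c b : ℝ} (h : HasGainBias (fun t => u t - v t) c b) :
    PrefV u v ↔ 0 < c ∨ c = 0 ∧ 0 ≤ b := by
  obtain ⟨e, he, hd⟩ := h.exists_average_eq
  refine zero_le_liminf_iff (g := fun n : ℕ => ((n : ℝ) + 1) / 2) (e := e) ?_ he ?_
  · exact (tendsto_atTop_add_const_right _ _ tendsto_natCast_atTop_atTop).atTop_div_const two_pos
  · filter_upwards [eventually_gt_atTop 0] with n hn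
    exact hd n hn

/-- A bounded sequence as a stream. -/
def RewardStream.ofBounded (y : ℕ → ℝ) (C : ℝ) (hy : ∀ t, |y t| ≤ C) : RewardStream :=
  ⟨y, memℓp_infty ⟨C, by rintro _ ⟨t, rfl⟩; exact hy t⟩⟩

@[simp]
theorem RewardStream.ofBounded_apply (y : ℕ → ℝ) (C : ℝ) (hy : ∀ t, |y t| ≤ C) (t : ℕ) :
    RewardStream.ofBounded y C hy t = y t := rfl

/-- The stream `(b, 0, 0, …)`. -/
noncomputable def RewardStream.single (b : ℝ) : RewardStream := RewardStream.cons b 0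

theorem RewardStream.ext_apply {u v : RewardStream} (h : ∀ t, u t = v t) : u = v :=
  lp.ext (funext h)

/-! ### Consequences of the axioms -/

section Preference

variable {R : RewardStream → RewardStream → Prop}

theorem AxiomA2.iff_sub (hA2 : AxiomA2 R) (u v : RewardStream) : R u v ↔ R (u - v) 0 := by
  constructor
  · intro h
    simpa [sub_eq_add_neg] using hA2 _ _ (-v) h
  · intro h
    simpa using hA2 _ _ v h

/-- The compensation principle makes the difference `y_t - y_{t+1}` of a stream with vanishing
long-run average as good as receiving `y_0` at once. -/
theorem equallyGood_single (hA2 : AxiomA2 R) (hA3 : AxiomA3 R) {y : ℕ → ℝ} {C : ℝ}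
    (hy : ∀ t, |y t| ≤ C)
    (hmean : Tendsto (fun n : ℕ => (1 / (n : ℝ)) * ∑ t ∈ Finset.range n, y (t + 1)) atTop (𝓝 0))
    {d : RewardStream} (hd : ∀ t, d t = y t - y (t + 1)) :
    EquallyGood R (RewardStream.single (y 0)) d := by
  -- A3 gives `(0, w) ∼ w`; adding `y` cancels all but `y 0` on the left and yields `d` on the
  -- right.
  set w : RewardStream := RewardStream.ofBounded (fun t => -y (t + 1)) C
    (fun t => by rw [abs_neg]; exact hy _) with hw
  set Y : RewardStream := RewardStream.ofBounded y C hy with hY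
  have hwmean : HasLongRunAverage w 0 := by
    have := hmean.neg
    simpa [HasLongRunAverage, hw] using this
  have h1 : RewardStream.cons 0 w + Y = RewardStream.single (y 0) := by
    refine RewardStream.ext_apply fun t => ?_
    cases t with
    | zero => exact zero_add (y 0)
    | succ t => exact neg_add_cancel (y (t + 1))
  have h2 : w + Y = d := by
    refine RewardStream.ext_apply fun t => ?_
    rw [hd, lp.coeFn_add, Pi.add_apply, hw, hY, RewardStream.ofBounded_apply,
      RewardStream.ofBounded_apply]
    ring
  obtain ⟨ha, hb⟩ := hA3 w 0 hwmean
  rw [← h1, ← h2]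
  exact ⟨hA2 _ _ Y ha, hA2 _ _ Y hb⟩

theorem dominates_single {b : ℝ} (hb : 0 < b) : Dominates (RewardStream.single b) 0 := by
  refine ⟨fun t => ?_, 0, hb⟩
  cases t with
  | zero => exact hb.le
  | succ t => exact le_rfl

theorem single_zero : RewardStream.single 0 = 0 :=
  RewardStream.ext_apply fun t => by cases t <;> rfl

/-- A sequence that is eventually the difference of a bounded sequence has long-run average `0`. -/
theorem tendsto_average_zero {y z : ℕ → ℝ} {C : ℝ} (hz : ∀ t, |z t| ≤ C)
    (hy : ∃ K, ∀ t ≥ K, y t = z t - z (t + 1)) :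
    Tendsto (fun n : ℕ => (1 / (n : ℝ)) * ∑ t ∈ Finset.range n, y t) atTop (𝓝 0) := by
  obtain ⟨K, hK⟩ := hy
  set c := ∑ t ∈ Finset.range K, y t with hc
  have hsum : ∀ n ≥ K, ∑ t ∈ Finset.range n, y t = c + (z K - z n) := by
    intro n hn
    induction n, hn using Nat.le_induction with
    | base => simp [hc]
    | succ n hn ih => rw [Finset.sum_range_succ, ih, hK n hn]; ring
  have hlim : Tendsto (fun n : ℕ => (1 / (n : ℝ)) * (|c| + (C + C))) atTop (𝓝 0) := by
    simpa using tendsto_one_div_atTop_nhds_zero_nat.mul_const (|c| + (C + C))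
  refine squeeze_zero_norm' ?_ hlim
  filter_upwards [eventually_ge_atTop K] with n hn
  rw [hsum n hn, norm_mul, Real.norm_of_nonneg (by positivity : (0 : ℝ) ≤ 1 / (n : ℝ))]
  refine mul_le_mul_of_nonneg_left ?_ (by positivity)
  exact (abs_add_le _ _).trans (add_le_add le_rfl ((abs_sub _ _).trans (add_le_add (hz K) (hz n))))

/-- With gain `0`, a stream is as good as receiving its bias at once. -/
theorem HasGainBias.equallyGood_single (hA2 : AxiomA2 R) (hA3 : AxiomA3 R) {d : RewardStream}
    {b : ℝ} (h : HasGainBias d 0 b) : EquallyGood R (RewardStream.single b) d := by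
  obtain ⟨z, C, hz, rfl, hd⟩ := h
  refine Blackwell.equallyGood_single (y := fun t => z t - z (t + 1)) (C := C + C) hA2 hA3
    (fun t => (abs_sub _ _).trans (add_le_add (hz t) (hz (t + 1)))) ?_ fun t => ?_
  · exact tendsto_average_zero (z := fun t => z (t + 1)) (fun t => hz _) ⟨0, fun t _ => rfl⟩
  · rw [hd]
    ring

/-- A positive gain outweighs any bias: `d` dominates the stream `d'` that loses the gain from index
`K` on, and `d'` is worth `b + c * K > 0` at once. -/
theorem strictlyBetter_of_gain_pos (htrans : ∀ u v w, R u v → R v w → R u w)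
    (hA1 : AxiomA1 R) (hA2 : AxiomA2 R) (hA3 : AxiomA3 R) {d : RewardStream} {c b : ℝ}
    (h : HasGainBias d c b) (hc : 0 < c) : StrictlyBetter R d 0 := by
  obtain ⟨z, C, hz, hb, hd⟩ := h
  obtain ⟨K, hK⟩ := exists_nat_gt (-b / c)
  have hpos : 0 < b + c * K := by
    rw [div_lt_iff₀ hc] at hK
    linarith
  have hyb : ∀ t, |z t - z (t + 1) + c * ((K - t : ℕ) : ℝ)| ≤ C + C + c * K := by
    intro t
    refine (abs_add_le _ _).trans (add_le_add ((abs_sub _ _).trans (add_le_add (hz _) (hz _))) ?_)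
    rw [abs_of_nonneg (by positivity)]
    exact mul_le_mul_of_nonneg_left (by exact_mod_cast Nat.sub_le K t) hc.le
  -- Truncated subtraction is intended: the last term decreases by `c` at each step before `K` and
  -- is zero afterwards, so `y` is bounded with mean zero.
  set y : ℕ → ℝ := fun t => z t - z (t + 1) + c * ((K - t : ℕ) : ℝ) with hy
  set d' : RewardStream := RewardStream.ofBounded (fun t => y t - y (t + 1)) _
    (fun t => (abs_sub _ _).trans (add_le_add (hyb t) (hyb (t + 1)))) with hd'
  have hmean : Tendsto (fun n : ℕ => (1 / (n : ℝ)) * ∑ t ∈ Finset.range n, y (t + 1))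
      atTop (𝓝 0) := by
    refine tendsto_average_zero (z := fun t => z (t + 1)) (fun t => hz _) ⟨K, fun t ht => ?_⟩
    simp [hy, Nat.sub_eq_zero_of_le (ht.trans (Nat.le_succ t))]
  have heq := equallyGood_single (d := d') hA2 hA3 hyb hmean fun t => rfl
  have hy0 : y 0 = b + c * K := by simp [hy, hb]
  have hdiff : ∀ t, d t - d' t = if t < K then 0 else c := by
    intro t
    rw [hd, hd', RewardStream.ofBounded_apply]
    simp only [hy]
    split_ifs with ht
    · have h1 : ((K - t : ℕ) : ℝ) = ((K - (t + 1) : ℕ) : ℝ) + 1 := by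
        exact_mod_cast (by omega : K - t = K - (t + 1) + 1)
      rw [h1]
      ring
    · have h1 : K - t = 0 := by omega
      have h2 : K - (t + 1) = 0 := by omega
      rw [h1, h2]
      push_cast
      ring
  have hdom : Dominates d d' := by
    refine ⟨fun t => ?_, K, ?_⟩
    · have := hdiff t
      split_ifs at this <;> linarith
    · have := hdiff K
      rw [if_neg (lt_irrefl K)] at this
      linarith
  have hs := hA1 _ _ (dominates_single hpos)
  rw [show z 0 - z (0 + 1) + c * ((K - 0 : ℕ) : ℝ) = b + c * K from hy0] at heq
  have h1 := hA1 _ _ hdom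
  have h2 : R d' 0 := htrans _ _ _ heq.2 hs.1
  exact ⟨htrans _ _ _ h1.1 h2, fun h0 => h1.2 (htrans _ _ _ h2 h0)⟩

theorem strictlyBetter_of_bias_pos (htrans : ∀ u v w, R u v → R v w → R u w)
    (hA1 : AxiomA1 R) (hA2 : AxiomA2 R) (hA3 : AxiomA3 R) {d : RewardStream} {b : ℝ}
    (h : HasGainBias d 0 b) (hb : 0 < b) : StrictlyBetter R d 0 := by
  obtain ⟨h1, h2⟩ := h.equallyGood_single hA2 hA3
  have hs := hA1 _ _ (dominates_single hb)
  exact ⟨htrans _ _ _ h2 hs.1, fun h0 => hs.2 (htrans _ _ _ h0 h2)⟩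

/-- The lexicographic order is total, so strict preference in its strict cases also settles the
converse, without assuming `R` complete. In the tie, the difference is equivalent to `single 0 = 0`.
-/
theorem preference_iff (htrans : ∀ u v w, R u v → R v w → R u w)
    (hA1 : AxiomA1 R) (hA2 : AxiomA2 R) (hA3 : AxiomA3 R) {u v : RewardStream} {cu bu cv bv : ℝ}
    (hu : HasGainBias u cu bu) (hv : HasGainBias v cv bv) :
    R u v ↔ 0 < cu - cv ∨ cu - cv = 0 ∧ 0 ≤ bu - bv := by
  have hstrict : ∀ {u v : RewardStream} {cu bu cv bv : ℝ}, HasGainBias u cu bu →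
      HasGainBias v cv bv → (0 < cu - cv ∨ cu - cv = 0 ∧ 0 < bu - bv) →
      R u v ∧ ¬ R v u := by
    intro u v cu bu cv bv hu hv h
    have huv : HasGainBias (u - v : RewardStream) (cu - cv) (bu - bv) := hu.sub hv
    have hs : StrictlyBetter R (u - v) 0 := by
      rcases h with hc | ⟨hc, hb⟩
      · exact strictlyBetter_of_gain_pos htrans hA1 hA2 hA3 huv hc
      · exact strictlyBetter_of_bias_pos htrans hA1 hA2 hA3 (hc ▸ huv) hb
    refine ⟨(hA2.iff_sub u v).mpr hs.1, fun h => hs.2 ?_⟩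
    simpa [sub_eq_add_neg] using hA2 _ _ (-v) h
  constructor
  · intro h
    by_contra hcon
    push Not at hcon
    refine (hstrict hv hu ?_).2 h
    rcases hcon.1.lt_or_eq with hc | hc
    · left; linarith
    · right; exact ⟨by linarith, by linarith [hcon.2 hc]⟩
  · rintro (hc | ⟨hc, hb⟩)
    · exact (hstrict hu hv (Or.inl hc)).1
    · rcases hb.lt_or_eq with hb | hb
      · exact (hstrict hu hv (Or.inr ⟨hc, hb⟩)).1
      · have huv : HasGainBias (u - v : RewardStream) (cu - cv) (bu - bv) := hu.sub hv
        rw [hc, ← hb] at huv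
        have := (huv.equallyGood_single hA2 hA3).2
        rw [single_zero] at this
        exact (hA2.iff_sub u v).mpr this

end Preference

end Blackwell

theorem theorem1 (R : Blackwell.RewardStream → Blackwell.RewardStream → Prop)
    (hrefl : ∀ u, R u u)
    (htrans : ∀ u v w, R u v → R v w → R u w)
    (hA1 : Blackwell.AxiomA1 R)
    (hA2 : Blackwell.AxiomA2 R)
    (hA3 : Blackwell.AxiomA3 R) :
    Blackwell.CoincideOn R Blackwell.PrefB Blackwell.UStat ∧
      Blackwell.CoincideOn R Blackwell.PrefV Blackwell.UStat := by
  constructor <;> intro u hu v hv <;>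
    obtain ⟨cu, bu, hu⟩ := Blackwell.hasGainBias_of_mem_UStat hu <;>
    obtain ⟨cv, bv, hv⟩ := Blackwell.hasGainBias_of_mem_UStat hv <;>
    rw [Blackwell.preference_iff htrans hA1 hA2 hA3 hu hv]
  · exact (Blackwell.prefB_iff (hu.sub hv)).symm
  · exact (Blackwell.prefV_iff (hu.sub hv)).symm
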